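/- Let $A>1$ and $q>0$. There is a constant $c>0$, depending only on $A$ and $q$, such that the following holds for all integers $d\ge 1$, $M\ge 2$ and $n$ with $\log M\le 16(\min(1,A-1))^2\,n$. Let $\mathcal F(A)$ be the set of probability densities on $\mathbb R^d$ (with respect to Lebesgue measure) bounded by $A$, let $\mathcal F_v(A)$ be the set of measurable functions $g:\mathbb R^d\to\mathbb R$ with $|g|\le A$, and let $v(f,g)=\int_{\mathbb R^d}|f(x)-g(x)|\,dx\in[0,\infty]$. Then $$\sup_{f_1,\dots,f_M\in\mathcal F_v(A)}\ \inf_{\hat f_n}\ \sup_{f\in\mathcal F(A)}\Big[\mathbb E_f\big[v(f,\hat f_n)^q\big]-\min_{j=1,\dots,M}v(f,f_j)^q\Big]\ \ge\ c\Big(\frac{\log M}{n}\Big)^{q/2}.$$ Here the infimum is over all estimators $\hat f_n$ based on $n$ observations $X_1,\dots,X_n$ in $\mathbb R^d$, that is, all functions $\hat f_n(x;X_1,\dots,X_n)$ with real values that are jointly measurable in $(x,X_1,\dots,X_n)$, and $\mathbb E_f$ is the expectation when $X_1,\dots,X_n$ are i.i.d. with density $f$. The bracket is read as $-\infty$ when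 the minimum in it is infinite. -/

import Mathlib

open MeasureTheory
open scoped ENNReal

noncomputable section

namespace Aggregation

variable {X : Type*} [MeasurableSpace X]

/-- The probability densities on `X` with respect to `ν` that are bounded by `A`. -/
def boundedDensities (ν : Measure X) (A : ℝ) : Set (X → ℝ) :=
  {f | Measurable f ∧ (∀ x, 0 ≤ f x) ∧ (∀ x, f x ≤ A) ∧ ∫⁻ x, ENNReal.ofReal (f x) ∂ν = 1}

/-- The measurable real functions on `X` that are bounded by `A` in absolute value. -/
def boundedFunctions (X : Type*) [MeasurableSpace X] (A : ℝ) : Set (X → ℝ) :=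
  {f | Measurable f ∧ ∀ x, |f x| ≤ A}

/-- The `L₁`-distance `v(f, g) = ∫ |f - g| dν`, with value `∞` if `f - g` is not integrable. -/
def l1Dist (ν : Measure X) (f g : X → ℝ) : ℝ≥0∞ :=
  ∫⁻ x, ENNReal.ofReal |f x - g x| ∂ν

/-- The law of `n` i.i.d. observations with density `f` with respect to `ν`. -/
def sampleLaw (ν : Measure X) (n : ℕ) (f : X → ℝ) : Measure (Fin n → X) :=
  Measure.pi fun _ => ν.withDensity fun x => ENNReal.ofReal (f x)

/-- The estimators based on a sample of size `n`: real functions on `X` that depend on the sample,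
measurable jointly in the sample and the point. No other restriction (sign, total mass,
integrability) is imposed on the values of an estimator. -/
def estimators (X : Type*) [MeasurableSpace X] (n : ℕ) : Set ((Fin n → X) → X → ℝ) :=
  {e | Measurable (Function.uncurry e)}

/-- The risk `E_f [v(f, e) ^ q]` of the estimator `e` when the true density is `f`. -/
def l1Risk (ν : Measure X) (n : ℕ) (q : ℝ) (f : X → ℝ) (e : (Fin n → X) → X → ℝ) : ℝ≥0∞ :=
  ∫⁻ s, l1Dist ν f (e s) ^ q ∂(sampleLaw ν n f)

/-- The excess risk `E_f [v(f, e) ^ q] - min_j v(f, g_j) ^ q`, as an extended real number. If the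
minimum is infinite, its value is `-∞`, even where the risk is infinite as well. -/
def l1ExcessRisk (ν : Measure X) {M : ℕ} (n : ℕ) (q : ℝ) (g : Fin M → X → ℝ)
    (e : (Fin n → X) → X → ℝ) (f : X → ℝ) : EReal :=
  (l1Risk ν n q f e : EReal) - ((⨅ j, l1Dist ν f (g j) ^ q : ℝ≥0∞) : EReal)

end Aggregation

end

/-!
Perturb the uniform density on a set `Q` of measure one by `δ r`, where `r` runs over `M` pairwise
orthogonal `±1`-valued functions of mean zero, such as Rademacher functions. Any two of these
densities are at `L₁`-distance exactly `δ`, so an estimator that is within `δ / 2` of the true one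
identifies it. On the other hand, each density has second moment `1 + δ ^ 2` with respect to the
uniform law, so by Cauchy–Schwarz a test based on `n` observations identifies it with probability
at most `√((1 + δ ^ 2) ^ n / M)` on average. With `δ = √(log M / n) / 4` this is bounded away from
one, and Markov's inequality bounds the risk from below. The minimum in the excess risk vanishes
because the true density is one of the `f_j`.
-/

namespace Aggregation

section ProductDensity

variable {ι : Type*} [Fintype ι] {X : ι → Type*} [∀ i, MeasurableSpace (X i)]
  (μ : ∀ i, Measure (X i)) [∀ i, IsProbabilityMeasure (μ i)]

lemma lintegral_pi_prod {f : ∀ i, X i → ℝ≥0∞} (hf : ∀ i, Measurable (f i)) :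
    ∫⁻ s, ∏ i, f i (s i) ∂Measure.pi μ = ∏ i, ∫⁻ x, f i x ∂μ i := by
  rw [ProbabilityTheory.lintegral_prod_eq_prod_lintegral_of_indepFun Finset.univ
    (fun i (s : ∀ i, X i) => f i (s i))
    (ProbabilityTheory.iIndepFun_pi fun i => (hf i).aemeasurable)
    fun i => (hf i).comp (measurable_pi_apply i)]
  exact Finset.prod_congr rfl fun i _ => (measurePreserving_eval μ i).lintegral_comp (hf i)

lemma pi_withDensity {h : ∀ i, X i → ℝ≥0∞} (hh : ∀ i, Measurable (h i))
    [∀ i, SigmaFinite ((μ i).withDensity (h i))] :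
    Measure.pi (fun i => (μ i).withDensity (h i)) =
      (Measure.pi μ).withDensity fun s => ∏ i, h i (s i) := by
  refine Measure.pi_eq fun B hB => ?_
  have indicator_prod (s : ∀ i, X i) : (Set.univ.pi B).indicator (fun s => ∏ i, h i (s i)) s =
      ∏ i, (B i).indicator (h i) (s i) := by
    by_cases hs : s ∈ Set.univ.pi B
    · rw [Set.indicator_of_mem hs]
      exact Finset.prod_congr rfl fun i _ => (Set.indicator_of_mem (hs i trivial) _).symm
    · obtain ⟨i, hi⟩ : ∃ i, s i ∉ B i := by simpa only [Set.mem_univ_pi, not_forall] using hs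
      rw [Set.indicator_of_notMem hs]
      exact (Finset.prod_eq_zero (Finset.mem_univ i) (Set.indicator_of_notMem hi _)).symm
  rw [withDensity_apply _ (.univ_pi hB), ← lintegral_indicator (.univ_pi hB)]
  simp_rw [indicator_prod]
  rw [lintegral_pi_prod μ fun i => (hh i).indicator (hB i)]
  exact Finset.prod_congr rfl fun i _ => by
    rw [lintegral_indicator (hB i), withDensity_apply _ (hB i)]

end ProductDensity

section Testing

variable {Ω : Type*} [MeasurableSpace Ω] {P : Measure Ω}

lemma withDensity_apply_le_sqrt {L : Ω → ℝ≥0∞} (hL : Measurable L) {B : Set Ω}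
    (hB : MeasurableSet B) :
    P.withDensity L B ≤ P B ^ (1 / 2 : ℝ) * (∫⁻ s, L s ^ 2 ∂P) ^ (1 / 2 : ℝ) := by
  have holder := ENNReal.lintegral_mul_le_Lp_mul_Lq (P.restrict B) .two_two
    aemeasurable_one hL.aemeasurable
  simp only [Pi.mul_apply, one_mul, ENNReal.rpow_two, one_pow,
    lintegral_one, Measure.restrict_apply_univ] at holder
  rw [withDensity_apply _ hB]
  refine holder.trans ?_
  gcongr
  exact Measure.restrict_le_self

lemma sum_withDensity_apply_le_sqrt [IsProbabilityMeasure P] {ι : Type*} [Fintype ι]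
    {L : ι → Ω → ℝ≥0∞} (hL : ∀ j, Measurable (L j)) {B : ι → Set Ω} (hB : ∀ j, MeasurableSet (B j))
    (hdisj : Pairwise (Function.onFun Disjoint B)) :
    ∑ j, P.withDensity (L j) (B j) ≤ (∑ j, ∫⁻ s, L j s ^ 2 ∂P) ^ (1 / 2 : ℝ) := by
  have sum_le_one : ∑ j, P (B j) ≤ 1 := by
    calc ∑ j, P (B j) = P (⋃ j, B j) := by rw [measure_iUnion hdisj hB, tsum_fintype]
      _ ≤ 1 := prob_le_one
  have sq_rpow (a : ℝ≥0∞) : (a ^ (1 / 2 : ℝ)) ^ (2 : ℝ) = a := by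
    rw [← ENNReal.rpow_mul, one_div_mul_cancel two_ne_zero, ENNReal.rpow_one]
  calc ∑ j, P.withDensity (L j) (B j)
      ≤ ∑ j, P (B j) ^ (1 / 2 : ℝ) * (∫⁻ s, L j s ^ 2 ∂P) ^ (1 / 2 : ℝ) :=
        Finset.sum_le_sum fun j _ => withDensity_apply_le_sqrt (hL j) (hB j)
    _ ≤ (∑ j, P (B j)) ^ (1 / 2 : ℝ) * (∑ j, ∫⁻ s, L j s ^ 2 ∂P) ^ (1 / 2 : ℝ) := by
        simpa only [sq_rpow] using ENNReal.inner_le_Lp_mul_Lq Finset.univ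
          (fun j => P (B j) ^ (1 / 2 : ℝ)) (fun j => (∫⁻ s, L j s ^ 2 ∂P) ^ (1 / 2 : ℝ)) .two_two
    _ ≤ (∑ j, ∫⁻ s, L j s ^ 2 ∂P) ^ (1 / 2 : ℝ) :=
        mul_le_of_le_one_left' (ENNReal.rpow_le_one sum_le_one (by norm_num))

end Testing

section Risk

variable {X : Type*} [MeasurableSpace X] {ν : Measure X} {n : ℕ} {q : ℝ}

lemma l1Dist_eq_lintegral_edist (f g : X → ℝ) : l1Dist ν f g = ∫⁻ x, edist (f x) (g x) ∂ν := by
  simp only [l1Dist, edist_dist, Real.dist_eq]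

@[simp]
lemma l1Dist_self (f : X → ℝ) : l1Dist ν f f = 0 := by
  simp [l1Dist]

lemma l1Dist_triangle_right {f g h : X → ℝ} (hf : Measurable f) (hh : Measurable h) :
    l1Dist ν f g ≤ l1Dist ν f h + l1Dist ν g h := by
  simpa only [l1Dist_eq_lintegral_edist] using
    lintegral_edist_triangle hf.aestronglyMeasurable hh.aestronglyMeasurable

lemma measurable_l1Dist_estimator [SFinite ν] {f : X → ℝ} (hf : Measurable f)
    {e : (Fin n → X) → X → ℝ} (he : e ∈ estimators X n) :
    Measurable fun s => l1Dist ν f (e s) := by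
  have he : Measurable (Function.uncurry e) := he
  have integrand_measurable :
      Measurable fun p : (Fin n → X) × X => ENNReal.ofReal |f p.2 - e p.1 p.2| :=
    ENNReal.measurable_ofReal.comp
      (continuous_abs.measurable.comp ((hf.comp measurable_snd).sub he))
  exact integrand_measurable.lintegral_prod_right'

lemma rpow_mul_sampleLaw_le_l1Risk [SFinite ν] (hq : 0 ≤ q) {f : X → ℝ} (hf : Measurable f)
    {e : (Fin n → X) → X → ℝ} (he : e ∈ estimators X n) (ρ : ℝ≥0∞) :
    ρ ^ q * sampleLaw ν n f {s | ρ ≤ l1Dist ν f (e s)} ≤ l1Risk ν n q f e :=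
  calc ρ ^ q * sampleLaw ν n f {s | ρ ≤ l1Dist ν f (e s)}
      ≤ ρ ^ q * sampleLaw ν n f {s | ρ ^ q ≤ l1Dist ν f (e s) ^ q} := by
        gcongr ρ ^ q * sampleLaw ν n f ?_
        exact fun s hs => ENNReal.rpow_le_rpow hs hq
    _ ≤ l1Risk ν n q f e :=
        mul_meas_ge_le_lintegral ((measurable_l1Dist_estimator hf he).pow_const q) _

lemma exists_mul_rpow_le_l1Risk [SFinite ν] {ι : Type*} [Fintype ι] [Nonempty ι] (hq : 0 ≤ q)
    {f : ι → X → ℝ} (hf : ∀ j, Measurable (f j))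
    [∀ j, IsProbabilityMeasure (sampleLaw ν n (f j))] {ρ p : ℝ≥0∞}
    (hsep : Pairwise fun j k => 2 * ρ ≤ l1Dist ν (f j) (f k))
    (htest : ∀ B : ι → Set (Fin n → X), (∀ j, MeasurableSet (B j)) →
      Pairwise (Function.onFun Disjoint B) →
        ∑ j, sampleLaw ν n (f j) (B j) ≤ Fintype.card ι * p)
    {e : (Fin n → X) → X → ℝ} (he : e ∈ estimators X n) :
    ∃ j, (1 - p) * ρ ^ q ≤ l1Risk ν n q (f j) e := by
  let B : ι → Set (Fin n → X) := fun j => {s | l1Dist ν (f j) (e s) < ρ}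
  have hB (j : ι) : MeasurableSet (B j) :=
    measurableSet_lt (measurable_l1Dist_estimator (hf j) he) measurable_const
  have hdisj : Pairwise (Function.onFun Disjoint B) := by
    refine fun j k hjk => Set.disjoint_left.2 fun s hj hk => ?_
    have hes : Measurable (e s) := Measurable.of_uncurry_left he
    have : 2 * ρ < 2 * ρ :=
      calc 2 * ρ ≤ l1Dist ν (f j) (f k) := hsep hjk
        _ ≤ l1Dist ν (f j) (e s) + l1Dist ν (f k) (e s) := l1Dist_triangle_right (hf j) hes
        _ < ρ + ρ := ENNReal.add_lt_add hj hk
        _ = 2 * ρ := (two_mul ρ).symm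
    exact lt_irrefl _ this
  obtain ⟨j, hj⟩ : ∃ j, sampleLaw ν n (f j) (B j) ≤ p := by
    by_contra! hlt
    refine (htest B hB hdisj).not_gt ?_
    simpa only [Finset.sum_const, Finset.card_univ, nsmul_eq_mul] using
      ENNReal.sum_lt_sum_of_nonempty (Finset.univ_nonempty (α := ι)) fun j _ => hlt j
  refine ⟨j, ?_⟩
  calc (1 - p) * ρ ^ q ≤ (1 - sampleLaw ν n (f j) (B j)) * ρ ^ q := by gcongr
    _ = ρ ^ q * sampleLaw ν n (f j) {s | ρ ≤ l1Dist ν (f j) (e s)} := by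
        rw [← prob_compl_eq_one_sub (hB j), mul_comm]
        simp only [B, Set.compl_ofPred, not_lt]
    _ ≤ l1Risk ν n q (f j) e := rpow_mul_sampleLaw_le_l1Risk hq (hf j) he ρ

lemma l1ExcessRisk_self {M : ℕ} (hq : 0 < q) (g : Fin M → X → ℝ) (e : (Fin n → X) → X → ℝ)
    (j : Fin M) : l1ExcessRisk ν n q g e (g j) = l1Risk ν n q (g j) e := by
  have min_eq_zero : ⨅ k, l1Dist ν (g j) (g k) ^ q = 0 :=
    le_antisymm ((iInf_le _ j).trans_eq (by simp [hq])) zero_le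
  rw [l1ExcessRisk, min_eq_zero, EReal.coe_ennreal_zero, sub_zero]

end Risk

section Densities

variable {X : Type*} [MeasurableSpace X] {ν μ : Measure X} {A : ℝ} {f : X → ℝ}

lemma isProbabilityMeasure_withDensity (hf : f ∈ boundedDensities ν A) :
    IsProbabilityMeasure (ν.withDensity fun x => ENNReal.ofReal (f x)) :=
  ⟨by rw [withDensity_apply _ .univ, Measure.restrict_univ, hf.2.2.2]⟩

lemma isProbabilityMeasure_sampleLaw (hf : f ∈ boundedDensities ν A) (n : ℕ) :
    IsProbabilityMeasure (sampleLaw ν n f) := by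
  have := isProbabilityMeasure_withDensity hf
  unfold sampleLaw
  infer_instance

lemma mem_boundedFunctions_of_mem_boundedDensities (hf : f ∈ boundedDensities ν A) :
    f ∈ boundedFunctions X A :=
  ⟨hf.1, fun x => (abs_of_nonneg (hf.2.1 x)).trans_le (hf.2.2.1 x)⟩

lemma sampleLaw_eq_withDensity [IsProbabilityMeasure μ] (hf : f ∈ boundedDensities μ A) (n : ℕ) :
    sampleLaw μ n f =
      (Measure.pi fun _ => μ).withDensity fun s => ∏ i, ENNReal.ofReal (f (s i)) := by
  have := isProbabilityMeasure_withDensity hf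
  exact pi_withDensity _ fun _ => hf.1.ennreal_ofReal

lemma sum_sampleLaw_le_sqrt [IsProbabilityMeasure μ] {ι : Type*} [Fintype ι] {f : ι → X → ℝ}
    (hf : ∀ j, f j ∈ boundedDensities μ A) {n : ℕ} {B : ι → Set (Fin n → X)}
    (hB : ∀ j, MeasurableSet (B j)) (hdisj : Pairwise (Function.onFun Disjoint B)) :
    ∑ j, sampleLaw μ n (f j) (B j) ≤
      (∑ j, (∫⁻ x, ENNReal.ofReal (f j x) ^ 2 ∂μ) ^ n) ^ (1 / 2 : ℝ) := by
  have hmeas (j : ι) : Measurable fun x => ENNReal.ofReal (f j x) := (hf j).1.ennreal_ofReal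
  have second_moment (j : ι) :
      ∫⁻ s, (∏ i, ENNReal.ofReal (f j (s i))) ^ 2 ∂(Measure.pi fun _ : Fin n => μ) =
        (∫⁻ x, ENNReal.ofReal (f j x) ^ 2 ∂μ) ^ n := by
    simp_rw [← Finset.prod_pow]
    rw [lintegral_pi_prod (fun _ => μ) fun _ => (hmeas j).pow_const 2, Finset.prod_const,
      Finset.card_univ, Fintype.card_fin]
  simp_rw [fun j => sampleLaw_eq_withDensity (hf j) n, ← second_moment]
  exact sum_withDensity_apply_le_sqrt
    (fun j => Finset.measurable_fun_prod _ fun i _ => (hmeas j).comp (measurable_pi_apply i))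
    hB hdisj

lemma exists_le_l1Risk_of_second_moment_le [IsProbabilityMeasure μ] {ι : Type*} [Fintype ι]
    [Nonempty ι] {n : ℕ} {q : ℝ} (hq : 0 ≤ q) {f : ι → X → ℝ}
    (hf : ∀ j, f j ∈ boundedDensities μ A) {ρ p K : ℝ≥0∞}
    (hsep : Pairwise fun j k => 2 * ρ ≤ l1Dist μ (f j) (f k))
    (hmoment : ∀ j, ∫⁻ x, ENNReal.ofReal (f j x) ^ 2 ∂μ ≤ K)
    (hK : K ^ n ≤ Fintype.card ι * p ^ 2) {e : (Fin n → X) → X → ℝ} (he : e ∈ estimators X n) :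
    ∃ j, (1 - p) * ρ ^ q ≤ l1Risk μ n q (f j) e := by
  have (j : ι) : IsProbabilityMeasure (sampleLaw μ n (f j)) :=
    isProbabilityMeasure_sampleLaw (hf j) n
  refine exists_mul_rpow_le_l1Risk hq (fun j => (hf j).1) hsep (fun B hB hdisj => ?_) he
  calc ∑ j, sampleLaw μ n (f j) (B j)
      ≤ (∑ j, (∫⁻ x, ENNReal.ofReal (f j x) ^ 2 ∂μ) ^ n) ^ (1 / 2 : ℝ) :=
        sum_sampleLaw_le_sqrt hf hB hdisj
    _ ≤ (∑ _j : ι, Fintype.card ι * p ^ 2) ^ (1 / 2 : ℝ) := by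
        gcongr with j
        exact (pow_le_pow_left' (hmoment j) n).trans hK
    _ = ((Fintype.card ι * p) ^ (2 : ℝ)) ^ (1 / 2 : ℝ) := by
        rw [Finset.sum_const, Finset.card_univ, nsmul_eq_mul, ENNReal.rpow_two]
        ring_nf
    _ = Fintype.card ι * p := by
        rw [← ENNReal.rpow_mul, mul_one_div_cancel two_ne_zero, ENNReal.rpow_one]

end Densities

section Restriction

variable {X : Type*} [MeasurableSpace X] {ν : Measure X} {Q : Set X}

lemma withDensity_ofReal_indicator (hQ : MeasurableSet Q) (f : X → ℝ) :
    ν.withDensity (fun x => ENNReal.ofReal (Q.indicator f x)) =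
      (ν.restrict Q).withDensity fun x => ENNReal.ofReal (f x) := by
  rw [← withDensity_indicator hQ]
  exact congrArg ν.withDensity (Set.indicator_comp_of_zero ENNReal.ofReal_zero).symm

lemma sampleLaw_indicator (hQ : MeasurableSet Q) (n : ℕ) (f : X → ℝ) :
    sampleLaw ν n (Q.indicator f) = sampleLaw (ν.restrict Q) n f := by
  simp only [sampleLaw, withDensity_ofReal_indicator hQ]

lemma indicator_mem_boundedDensities (hQ : MeasurableSet Q) {A : ℝ} (hA : 0 ≤ A) {f : X → ℝ}
    (hf : f ∈ boundedDensities (ν.restrict Q) A) : Q.indicator f ∈ boundedDensities ν A := by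
  refine ⟨hf.1.indicator hQ, Set.indicator_nonneg fun x _ => hf.2.1 x,
    fun x => Set.indicator_apply_le' (fun _ => hf.2.2.1 x) fun _ => hA, ?_⟩
  rw [← setLIntegral_univ, ← withDensity_apply _ .univ, withDensity_ofReal_indicator hQ,
    withDensity_apply _ .univ, setLIntegral_univ, hf.2.2.2]

lemma l1Dist_restrict_le (hQ : MeasurableSet Q) (f g : X → ℝ) :
    l1Dist (ν.restrict Q) f g ≤ l1Dist ν (Q.indicator f) g :=
  calc l1Dist (ν.restrict Q) f g = ∫⁻ x in Q, ENNReal.ofReal |Q.indicator f x - g x| ∂ν :=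
        setLIntegral_congr_fun hQ fun x hx => by simp only [Set.indicator_of_mem hx]
    _ ≤ l1Dist ν (Q.indicator f) g := setLIntegral_le_lintegral _ _

lemma l1Risk_restrict_le (hQ : MeasurableSet Q) {n : ℕ} {q : ℝ} (hq : 0 ≤ q) (f : X → ℝ)
    (e : (Fin n → X) → X → ℝ) :
    l1Risk (ν.restrict Q) n q f e ≤ l1Risk ν n q (Q.indicator f) e := by
  rw [l1Risk, l1Risk, sampleLaw_indicator hQ]
  exact lintegral_mono fun s => ENNReal.rpow_le_rpow (l1Dist_restrict_le hQ f (e s)) hq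

end Restriction

/-- A measurable `±1`-valued function of mean zero. Two such functions `r`, `s` are orthogonal in
`L²(μ)` if and only if `r * s` is such a function as well, which is how orthogonality is expressed
below. -/
structure IsBalancedSign {X : Type*} [MeasurableSpace X] (μ : Measure X) (r : X → ℝ) : Prop where
  measurable : Measurable r
  abs_eq_one : ∀ x, |r x| = 1
  integral_eq_zero : ∫ x, r x ∂μ = 0

namespace IsBalancedSign

variable {X : Type*} [MeasurableSpace X] {μ : Measure X} {r s : X → ℝ}

lemma sq_eq_one (hr : IsBalancedSign μ r) (x : X) : r x ^ 2 = 1 := by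
  rw [← sq_abs, hr.abs_eq_one, one_pow]

lemma integrable [IsFiniteMeasure μ] (hr : IsBalancedSign μ r) : Integrable r μ :=
  .of_bound hr.measurable.aestronglyMeasurable 1 (.of_forall fun x => (hr.abs_eq_one x).le)

lemma comp_measurePreserving {Y : Type*} [MeasurableSpace Y] {ν : Measure Y} {φ : Y → X}
    (hr : IsBalancedSign μ r) (hφ : MeasurePreserving φ ν μ) :
    IsBalancedSign ν fun y => r (φ y) where
  measurable := hr.measurable.comp hφ.measurable
  abs_eq_one y := hr.abs_eq_one (φ y)
  integral_eq_zero := by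
    rw [← integral_map hφ.aemeasurable hr.measurable.aestronglyMeasurable, hφ.map_eq,
      hr.integral_eq_zero]

lemma abs_mul_le (hr : IsBalancedSign μ r) (δ : ℝ) (x : X) : |δ * r x| ≤ |δ| := by
  rw [abs_mul, hr.abs_eq_one, mul_one]

section Probability

variable [IsProbabilityMeasure μ]

lemma lintegral_ofReal_add_mul (hr : IsBalancedSign μ r) {a b : ℝ} (h : |b| ≤ a) :
    ∫⁻ x, ENNReal.ofReal (a + b * r x) ∂μ = ENNReal.ofReal a := by
  have hint : Integrable (fun x => b * r x) μ := hr.integrable.const_mul b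
  have hsum : Integrable (fun x => a + b * r x) μ := (integrable_const a).add hint
  have hnonneg (x : X) : 0 ≤ a + b * r x := by
    linarith [neg_le_of_abs_le ((hr.abs_mul_le b x).trans h)]
  rw [← ofReal_integral_eq_lintegral_ofReal hsum (.of_forall hnonneg),
    integral_add (integrable_const a) hint, integral_const_mul, hr.integral_eq_zero, mul_zero,
    add_zero, integral_const, probReal_univ, one_smul]

lemma one_add_mul_mem_boundedDensities (hr : IsBalancedSign μ r) {δ A : ℝ} (hδ : |δ| ≤ 1)
    (hδA : 1 + |δ| ≤ A) : (fun x => 1 + δ * r x) ∈ boundedDensities μ A := by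
  have hbound (x : X) : -|δ| ≤ δ * r x ∧ δ * r x ≤ |δ| := abs_le.1 (hr.abs_mul_le δ x)
  refine ⟨by have := hr.measurable; fun_prop, fun x => ?_, fun x => ?_, ?_⟩
  · linarith [(hbound x).1]
  · linarith [(hbound x).2]
  · rw [hr.lintegral_ofReal_add_mul hδ, ENNReal.ofReal_one]

lemma lintegral_ofReal_one_add_mul_sq (hr : IsBalancedSign μ r) {δ : ℝ} (hδ : |δ| ≤ 1) :
    ∫⁻ x, ENNReal.ofReal (1 + δ * r x) ^ 2 ∂μ = ENNReal.ofReal (1 + δ ^ 2) := by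
  have hsq (x : X) :
      ENNReal.ofReal (1 + δ * r x) ^ 2 = ENNReal.ofReal (1 + δ ^ 2 + 2 * δ * r x) := by
    rw [← ENNReal.ofReal_pow (by linarith [neg_le_of_abs_le ((hr.abs_mul_le δ x).trans hδ)])]
    congr 1
    linear_combination δ ^ 2 * hr.sq_eq_one x
  simp_rw [hsq]
  refine hr.lintegral_ofReal_add_mul (abs_le.2 ⟨?_, ?_⟩)
  · linarith [sq_nonneg (1 + δ)]
  · linarith [sq_nonneg (1 - δ)]

lemma l1Dist_one_add_mul (hr : IsBalancedSign μ r) (hs : IsBalancedSign μ s)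
    (hrs : IsBalancedSign μ (r * s)) (δ : ℝ) :
    l1Dist μ (fun x => 1 + δ * r x) (fun x => 1 + δ * s x) = ENNReal.ofReal |δ| := by
  have abs_sub_eq (x : X) : |r x - s x| = 1 - r x * s x := by
    rcases (abs_eq zero_le_one).1 (hr.abs_eq_one x) with h | h <;>
      rcases (abs_eq zero_le_one).1 (hs.abs_eq_one x) with h' | h' <;> norm_num [h, h']
  have integrand_eq (x : X) :
      |1 + δ * r x - (1 + δ * s x)| = |δ| + -|δ| * (r * s) x := by
    rw [add_sub_add_left_eq_sub, ← mul_sub, abs_mul, abs_sub_eq, Pi.mul_apply]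
    ring
  simp_rw [l1Dist, integrand_eq]
  exact hrs.lintegral_ofReal_add_mul (by rw [abs_neg, abs_abs])

end Probability

end IsBalancedSign

section Rademacher

open Function

lemma intervalIntegral_eq_zero_of_periodic_of_antiperiodic {E : Type*} [NormedAddCommGroup E]
    [NormedSpace ℝ E] {g : ℝ → E} {T c : ℝ} (hT : Periodic g T) (hc : Antiperiodic g c) (a : ℝ) :
    ∫ x in a..a + T, g x = 0 := by
  have eq_neg : ∫ x in a..a + T, g x = -∫ x in a..a + T, g x :=
    calc ∫ x in a..a + T, g x = ∫ x in a + c..a + c + T, g x := hT.intervalIntegral_add_eq _ _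
      _ = ∫ x in a..a + T, g (x + c) := by
          rw [intervalIntegral.integral_comp_add_right, add_right_comm]
      _ = -∫ x in a..a + T, g x := by simp_rw [hc _, intervalIntegral.integral_neg]
  have : IsAddTorsionFree E := .of_isTorsionFree ℝ E
  exact self_eq_neg.1 eq_neg

/-- The `k`-th Rademacher function, extended from `[0, 1)` to the real line by periodicity. The
numbering starts at zero: `rademacher 0` is `1` on `[0, 1/2)` and `-1` on `[1/2, 1)`. -/
noncomputable def rademacher (k : ℕ) (x : ℝ) : ℝ := if Even ⌊2 ^ (k + 1) * x⌋ then 1 else -1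

lemma abs_rademacher (k : ℕ) (x : ℝ) : |rademacher k x| = 1 := by
  unfold rademacher
  split_ifs <;> simp

lemma measurable_rademacher (k : ℕ) : Measurable (rademacher k) :=
  (Measurable.of_discrete (f := fun m : ℤ => if Even m then (1 : ℝ) else -1)).comp
    (Int.measurable_floor.comp (measurable_const_mul _))

lemma rademacher_antiperiodic (k : ℕ) : Antiperiodic (rademacher k) (1 / 2 ^ (k + 1)) := by
  intro x
  unfold rademacher
  rw [mul_add, mul_one_div_cancel (by positivity), Int.floor_add_one]
  by_cases h : Even ⌊2 ^ (k + 1) * x⌋ <;> simp [h]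

lemma rademacher_periodic {j k : ℕ} (h : j ≤ k) : Periodic (rademacher k) (1 / 2 ^ j) := by
  obtain ⟨m, rfl⟩ := Nat.exists_eq_add_of_le h
  have period_eq : (1 : ℝ) / 2 ^ j = (2 ^ m : ℕ) * (2 * (1 / 2 ^ (j + m + 1))) := by
    rw [pow_succ, pow_add]
    push_cast
    field_simp
  rw [period_eq]
  exact (rademacher_antiperiodic (j + m)).nat_even_mul_periodic (2 ^ m)

lemma isBalancedSign_of_periodic_of_antiperiodic {r : ℝ → ℝ} (hr : Measurable r)
    (habs : ∀ x, |r x| = 1) (hone : Periodic r 1) {c : ℝ} (hc : Antiperiodic r c) :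
    IsBalancedSign (volume.restrict (Set.Ioc 0 1)) r where
  measurable := hr
  abs_eq_one := habs
  integral_eq_zero := by
    rw [← intervalIntegral.integral_of_le zero_le_one]
    simpa only [zero_add] using intervalIntegral_eq_zero_of_periodic_of_antiperiodic hone hc 0

lemma rademacher_periodic_one (k : ℕ) : Periodic (rademacher k) 1 := by
  simpa only [pow_zero, div_one] using rademacher_periodic k.zero_le

lemma isBalancedSign_rademacher (k : ℕ) :
    IsBalancedSign (volume.restrict (Set.Ioc 0 1)) (rademacher k) :=
  isBalancedSign_of_periodic_of_antiperiodic (measurable_rademacher k) (abs_rademacher k)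
    (rademacher_periodic_one k) (rademacher_antiperiodic k)

lemma isBalancedSign_rademacher_mul {j k : ℕ} (h : j ≠ k) :
    IsBalancedSign (volume.restrict (Set.Ioc 0 1)) (rademacher j * rademacher k) := by
  wlog hjk : j < k generalizing j k
  · rw [mul_comm]
    exact this h.symm (h.lt_or_gt.resolve_left hjk)
  have antiperiodic : Antiperiodic (rademacher j * rademacher k) (1 / 2 ^ (j + 1)) := fun x => by
    rw [Pi.mul_apply, Pi.mul_apply, rademacher_antiperiodic j x, rademacher_periodic hjk x, neg_mul]
  refine isBalancedSign_of_periodic_of_antiperiodic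
    ((measurable_rademacher j).mul (measurable_rademacher k)) (fun x => ?_)
    ((rademacher_periodic_one j).mul (rademacher_periodic_one k)) antiperiodic
  rw [Pi.mul_apply, abs_mul, abs_rademacher, abs_rademacher, one_mul]

lemma measurePreserving_eval_restrict_pi {ι : Type*} [Fintype ι] {X : ι → Type*}
    [∀ i, MeasureSpace (X i)] [∀ i, SigmaFinite (volume : Measure (X i))] (s : ∀ i, Set (X i))
    [∀ i, IsProbabilityMeasure ((volume : Measure (X i)).restrict (s i))] (i : ι) :
    MeasurePreserving (Function.eval i) (volume.restrict (Set.univ.pi s))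
      (volume.restrict (s i)) := by
  rw [volume_pi, Measure.restrict_pi_pi]
  exact measurePreserving_eval _ i

instance isProbabilityMeasure_restrict_Ioc_zero_one :
    IsProbabilityMeasure ((volume : Measure ℝ).restrict (Set.Ioc 0 1)) :=
  ⟨by simp⟩

end Rademacher

section Minimax

variable {X : Type*} [MeasurableSpace X]

/-- The minimax excess risk: the largest excess risk over the densities bounded by `A` of the best
estimator based on `n` observations, for the least favourable `M` functions bounded by `A`. -/
noncomputable def minimaxExcessRisk (ν : Measure X) (A q : ℝ) (M n : ℕ) : EReal :=
  ⨆ g ∈ {g : Fin M → X → ℝ | ∀ j, g j ∈ boundedFunctions X A},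
    ⨅ e ∈ estimators X n, ⨆ f ∈ boundedDensities ν A, l1ExcessRisk ν n q g e f

variable {ν : Measure X} {A q a : ℝ} {M n : ℕ}

lemma le_minimaxExcessRisk (hq : 0 < q) {f : Fin M → X → ℝ} (hf : ∀ j, f j ∈ boundedDensities ν A)
    (h : ∀ e ∈ estimators X n, ∃ j, ENNReal.ofReal a ≤ l1Risk ν n q (f j) e) :
    (a : EReal) ≤ minimaxExcessRisk ν A q M n := by
  refine le_iSup₂_of_le f (fun j => mem_boundedFunctions_of_mem_boundedDensities (hf j))
    (le_iInf₂ fun e he => ?_)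
  obtain ⟨j, hj⟩ := h e he
  refine le_iSup₂_of_le (f j) (hf j) ?_
  calc (a : EReal) ≤ (ENNReal.ofReal a : EReal) := by
        rw [EReal.coe_ennreal_ofReal]
        exact EReal.coe_le_coe_iff.2 (le_max_left a 0)
    _ ≤ (l1Risk ν n q (f j) e : EReal) := EReal.coe_ennreal_le_coe_ennreal_iff.2 hj
    _ = l1ExcessRisk ν n q f e (f j) := (l1ExcessRisk_self hq f e j).symm

lemma le_minimaxExcessRisk_of_isBalancedSign [NeZero M] (hq : 0 < q) {Q : Set X}
    (hQ : MeasurableSet Q) (hνQ : ν Q = 1) {r : Fin M → X → ℝ}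
    (hr : ∀ j, IsBalancedSign (ν.restrict Q) (r j))
    (horth : Pairwise fun j k => IsBalancedSign (ν.restrict Q) (r j * r k))
    {δ p : ℝ} (hδ : 0 ≤ δ) (hδ1 : δ ≤ 1) (hδA : 1 + δ ≤ A) (hp : 0 ≤ p)
    (hδp : (1 + δ ^ 2) ^ n ≤ M * p ^ 2) :
    (((1 - p) * (δ / 2) ^ q : ℝ) : EReal) ≤ minimaxExcessRisk ν A q M n := by
  have : IsProbabilityMeasure (ν.restrict Q) := ⟨by rw [Measure.restrict_apply_univ, hνQ]⟩
  have habs : |δ| = δ := abs_of_nonneg hδ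
  have hdens (j : Fin M) : (fun x => 1 + δ * r j x) ∈ boundedDensities (ν.restrict Q) A :=
    (hr j).one_add_mul_mem_boundedDensities (habs.trans_le hδ1) (by rwa [habs])
  have hsep : Pairwise fun j k => 2 * ENNReal.ofReal (δ / 2) ≤
      l1Dist (ν.restrict Q) (fun x => 1 + δ * r j x) fun x => 1 + δ * r k x := fun j k hjk => by
    beta_reduce
    rw [(hr j).l1Dist_one_add_mul (hr k) (horth hjk), habs, ← ENNReal.ofReal_ofNat,
      ← ENNReal.ofReal_mul zero_le_two, mul_div_cancel₀ _ two_ne_zero]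
  refine le_minimaxExcessRisk hq
    (fun j => indicator_mem_boundedDensities hQ (by linarith) (hdens j)) fun e he => ?_
  obtain ⟨j, hj⟩ := exists_le_l1Risk_of_second_moment_le hq.le hdens hsep
    (fun j => ((hr j).lintegral_ofReal_one_add_mul_sq (habs.trans_le hδ1)).le)
    (p := ENNReal.ofReal p) (n := n) (by
      rw [Fintype.card_fin, ← ENNReal.ofReal_natCast, ← ENNReal.ofReal_pow hp,
        ← ENNReal.ofReal_pow (by positivity), ← ENNReal.ofReal_mul M.cast_nonneg]
      exact ENNReal.ofReal_le_ofReal hδp) he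
  refine ⟨j, le_trans (le_of_eq ?_) (hj.trans (l1Risk_restrict_le hQ hq.le _ e))⟩
  rw [ENNReal.ofReal_mul' (by positivity), ENNReal.ofReal_sub 1 hp, ENNReal.ofReal_one,
    ENNReal.ofReal_rpow_of_nonneg (by positivity) hq.le]

end Minimax

lemma one_add_pow_le_sqrt {x M : ℝ} {n : ℕ} (hx : 0 ≤ 1 + x) (hM : 0 < M)
    (h : n * x ≤ Real.log M / 2) : (1 + x) ^ n ≤ √M :=
  calc (1 + x) ^ n ≤ Real.exp x ^ n := by
        gcongr
        rw [add_comm]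
        exact Real.add_one_le_exp x
    _ = Real.exp (n * x) := (Real.exp_nat_mul x n).symm
    _ ≤ Real.exp (Real.log M / 2) := Real.exp_le_exp.2 h
    _ = √M := by rw [Real.exp_half, Real.exp_log hM]

lemma one_add_sq_pow_le_mul_sq {M : ℝ} (hM : 2 ≤ M) (n : ℕ) :
    (1 + (√(Real.log M / n) / 4) ^ 2) ^ n ≤ M * (7 / 8) ^ 2 := by
  have hlog : 0 ≤ Real.log M := Real.log_nonneg (by linarith)
  have exponent_le : n * (√(Real.log M / n) / 4) ^ 2 ≤ Real.log M / 2 := by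
    rw [div_pow, Real.sq_sqrt (by positivity)]
    linarith [mul_le_of_le_div₀ hlog n.cast_nonneg (le_refl (Real.log M / n))]
  calc (1 + (√(Real.log M / n) / 4) ^ 2) ^ n ≤ √M :=
        one_add_pow_le_sqrt (by positivity) (by linarith) exponent_le
    _ ≤ M * (7 / 8) ^ 2 := by nlinarith [Real.sq_sqrt (zero_le_two.trans hM), Real.sqrt_nonneg M]

end Aggregation

open Aggregation in
theorem mainTheorem4_general {X : Type*} [MeasurableSpace X] {ν : Measure X} {Q : Set X}
    (hQ : MeasurableSet Q) (hνQ : ν Q = 1) {A q : ℝ} (hA : 1 < A) (hq : 0 < q) {M n : ℕ}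
    (hM : 2 ≤ M) (hlog : Real.log M ≤ 16 * (min 1 (A - 1)) ^ 2 * n) {r : Fin M → X → ℝ}
    (hr : ∀ j, IsBalancedSign (ν.restrict Q) (r j))
    (horth : Pairwise fun j k => IsBalancedSign (ν.restrict Q) (r j * r k)) :
    (((1 / 8) ^ q / 8 * (Real.log M / n) ^ (q / 2) : ℝ) : EReal) ≤ minimaxExcessRisk ν A q M n := by
  have hM' : (2 : ℝ) ≤ M := by exact_mod_cast hM
  have : NeZero M := ⟨by omega⟩
  set u : ℝ := Real.log M / n
  have hu : 0 ≤ u := div_nonneg (Real.log_nonneg (by linarith)) n.cast_nonneg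
  have hδ : √u / 4 ≤ min 1 (A - 1) := by
    have hmin : 0 ≤ min 1 (A - 1) := le_min zero_le_one (by linarith)
    have : u ≤ 16 * min 1 (A - 1) ^ 2 := div_le_of_le_mul₀ n.cast_nonneg (by positivity) hlog
    rw [div_le_iff₀ four_pos, Real.sqrt_le_left (mul_nonneg hmin zero_le_four)]
    linarith
  have hrate : (1 - 7 / 8) * (√u / 4 / 2) ^ q = (1 / 8) ^ q / 8 * u ^ (q / 2) := by
    rw [show √u / 4 / 2 = 1 / 8 * √u by ring, Real.mul_rpow (by norm_num) (Real.sqrt_nonneg u),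
      Real.sqrt_eq_rpow, ← Real.rpow_mul hu, one_div_mul_eq_div]
    ring
  rw [← hrate]
  exact le_minimaxExcessRisk_of_isBalancedSign hq hQ hνQ hr horth (by positivity)
    (hδ.trans (min_le_left _ _)) (by linarith [hδ.trans (min_le_right _ _)]) (by norm_num)
    (one_add_sq_pow_le_mul_sq hM' n)

theorem mainTheorem4 (A q : ℝ) (hA : 1 < A) (hq : 0 < q) :
    ∃ c : ℝ, 0 < c ∧ ∀ d M n : ℕ, 1 ≤ d → 2 ≤ M →
      Real.log (M : ℝ) ≤ 16 * (min 1 (A - 1)) ^ 2 * (n : ℝ) →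
      ((c * (Real.log (M : ℝ) / (n : ℝ)) ^ (q / 2) : ℝ) : EReal) ≤
        ⨆ g ∈ {g : Fin M → (Fin d → ℝ) → ℝ |
            ∀ j, g j ∈ Aggregation.boundedFunctions (Fin d → ℝ) A},
          ⨅ e ∈ Aggregation.estimators (Fin d → ℝ) n,
            ⨆ f ∈ Aggregation.boundedDensities (volume : Measure (Fin d → ℝ)) A,
              Aggregation.l1ExcessRisk (volume : Measure (Fin d → ℝ)) n q g e f := by
  refine ⟨(1 / 8) ^ q / 8, by positivity, fun d M n hd hM hlog => ?_⟩
  have heval := Aggregation.measurePreserving_eval_restrict_pi (fun _ => Set.Ioc (0 : ℝ) 1)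
    (⟨0, hd⟩ : Fin d)
  exact mainTheorem4_general (.univ_pi fun _ => measurableSet_Ioc) (by simp [volume_pi_pi]) hA hq hM
    hlog (fun j => (Aggregation.isBalancedSign_rademacher j).comp_measurePreserving heval)
    fun j k hjk => (Aggregation.isBalancedSign_rademacher_mul
      (Fin.val_injective.ne hjk)).comp_measurePreserving heval
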